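/- Let $n\ge 1$, let $B$ be the closed Euclidean unit ball of $\mathbb{R}^n$ and $e_1=(1,0,\dots,0)$. Let $\mathrm{Lsc}(\mathbb{R}^n)$ be the set of lower semicontinuous functions $\phi:\mathbb{R}^n\to[-\infty,\infty]$, and write $\mathrm{epi}(\phi)=\{(x,s)\in\mathbb{R}^n\times\mathbb{R}:\phi(x)\le s\}$ and $G_\phi(s)=\{x\in\mathbb{R}^n:\phi(x)\le s\}$. The $\tau$-topology on $\mathrm{Lsc}(\mathbb{R}^n)$ is generated by the sets $\{\phi:\mathrm{epi}(\phi)\cap K=\emptyset\}$ with $K\subset\mathbb{R}^{n}\times\mathbb{R}$ compact and $\{\phi:\mathrm{epi}(\phi)\cap G\ne\emptyset\}$ with $G\subset\mathbb{R}^{n}\times\mathbb{R}$ open; thus $\phi_m\to\phi$ in $\tau$ if and only if $\limsup_m\mathrm{epi}(\phi_m)\subset\mathrm{epi}(\phi)\subset\liminf_m\mathrm{epi}(\phi_m)$. Let $\mathrm{Cvx}(\mathbb{R}^n)$ be the set of lower semicontinuous proper convex functions $\phi:\mathbb{R}^n\to\mathbb{R}\cup\{\infty\}$, let $\mathrm{Cvx}_0=\{\phi\in\mathrm{Cvx}(\mathbb{R}^n):\phi\ge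 0,\ \phi(0)=0\}$ and $\mathrm{Cvx}^+=\{\phi\in\mathrm{Cvx}(\mathbb{R}^n):0<\int_{\mathbb{R}^n}e^{-\phi(x)}\,dx<\infty\}$. Put $$\mathscr{S}_1=\bigcup_{0\le t\le n}\{\phi\in\mathrm{Cvx}_0:\ te_1+B\subset G_\phi(1)\subset 2nB\},\qquad \mathscr{S}_{1,c}=\Big\{\phi\in\mathscr{S}_1:\ \int_{\mathbb{R}^n}x\,e^{-\phi(x)}\,dx=0\Big\}$$ (so $\mathscr{S}_{1,c}$ consists of the members of $\mathscr{S}_1$ with centroid $0$), and $$\mathscr{S}_2=\bigcup_{0\le t\le n}\{\phi\in\mathrm{Cvx}^+:\ te_1+B\subset G_\phi(2n)\subset 2nB,\ \inf\phi=0,\ 0\le\phi(0)\le n\}.$$ Then each of $\mathscr{S}_1$, $\mathscr{S}_{1,c}$ and $\mathscr{S}_2$ is closed in $\mathrm{Lsc}(\mathbb{R}^n)$ with respect to $\tau$, and is compact in $\tau$. -/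

import Mathlib

open Set Filter Topology MeasureTheory

noncomputable section

namespace BlaschkeSantalo

/-- `ℝⁿ` with its Euclidean norm. -/
abbrev E (n : ℕ) : Type := EuclideanSpace ℝ (Fin n)

/-! ### Semi-limits of sequences of sets -/

/-- The upper limit of a sequence of sets: all limits of sequences `x_{m_j} ∈ K_{m_j}` along
subsequences `m_0 < m_1 < …`. -/
def limsupSet {X : Type*} [TopologicalSpace X] (K : ℕ → Set X) : Set X :=
  {x | ∃ m : ℕ → ℕ, StrictMono m ∧ ∃ u : ℕ → X, (∀ j, u j ∈ K (m j)) ∧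
    Tendsto u atTop (𝓝 x)}

/-- The lower limit of a sequence of sets: all limits of sequences `x_m` with `x_m ∈ K_m` for all
but finitely many `m`. -/
def liminfSet {X : Type*} [TopologicalSpace X] (K : ℕ → Set X) : Set X :=
  {x | ∃ M : ℕ, ∃ u : ℕ → X, (∀ m, M < m → u m ∈ K m) ∧ Tendsto u atTop (𝓝 x)}

/-- `K_m → L` in the `τ`-topology: `limsup K_m ⊆ L ⊆ liminf K_m`. -/
def TauConvergesSet {X : Type*} [TopologicalSpace X] (K : ℕ → Set X) (L : Set X) : Prop :=
  limsupSet K ⊆ L ∧ L ⊆ liminfSet K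

/-! ### Lower semicontinuous functions and the `τ`-topology -/

/-- Lower semicontinuous functions `ℝⁿ → [-∞, ∞]`. -/
structure LscFun (n : ℕ) where
  toFun : E n → EReal
  lsc' : LowerSemicontinuous toFun

instance (n : ℕ) : CoeFun (LscFun n) (fun _ => E n → EReal) := ⟨LscFun.toFun⟩

/-- The epigraph of `φ`, a closed subset of `ℝⁿ × ℝ`. -/
def LscFun.epi {n : ℕ} (φ : LscFun n) : Set (E n × ℝ) :=
  {p | φ p.1 ≤ (p.2 : EReal)}

/-- The sub-level set `G_φ(s)`. -/
def LscFun.sublevel {n : ℕ} (φ : LscFun n) (s : ℝ) : Set (E n) :=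
  {x | φ x ≤ (s : EReal)}

/-- The `τ`-topology on lower semicontinuous functions, which are identified with their epigraphs:
it is generated by the sets `{φ | epi φ ∩ K = ∅}` with `K` compact and
`{φ | epi φ ∩ G ≠ ∅}` with `G` open. -/
instance tauTopology (n : ℕ) : TopologicalSpace (LscFun n) :=
  TopologicalSpace.generateFrom
    ({U | ∃ K : Set (E n × ℝ), IsCompact K ∧ U = {φ : LscFun n | φ.epi ∩ K = ∅}} ∪
      {U | ∃ G : Set (E n × ℝ), IsOpen G ∧ U = {φ : LscFun n | (φ.epi ∩ G).Nonempty}})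

theorem LscFun.isClosed_epi {n : ℕ} (φ : LscFun n) : IsClosed φ.epi := by
  have h := φ.lsc'.isClosed_epigraph
  exact h.preimage (f := fun p : E n × ℝ => (p.1, (p.2 : EReal)))
    (continuous_fst.prodMk (continuous_coe_real_ereal.comp continuous_snd))

/-- Convergence of sequences in `tauTopology` is `τ`-convergence of the epigraphs. -/
theorem tendsto_tau_iff {n : ℕ} (φ : ℕ → LscFun n) (ψ : LscFun n) :
    Tendsto φ atTop (𝓝 ψ) ↔ TauConvergesSet (fun m => (φ m).epi) ψ.epi := by
  constructor
  · intro h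
    have h' := TopologicalSpace.tendsto_nhds_generateFrom_iff.1 h
    have hG : ∀ G : Set (E n × ℝ), IsOpen G → (ψ.epi ∩ G).Nonempty →
        ∀ᶠ m in atTop, ((φ m).epi ∩ G).Nonempty :=
      fun G hGo hne => h' _ (Or.inr ⟨G, hGo, rfl⟩) hne
    have hK : ∀ K : Set (E n × ℝ), IsCompact K → ψ.epi ∩ K = ∅ →
        ∀ᶠ m in atTop, (φ m).epi ∩ K = ∅ :=
      fun K hKc hd => h' _ (Or.inl ⟨K, hKc, rfl⟩) hd
    constructor
    · rintro x ⟨m, hm, u, hu, hux⟩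
      by_contra hx
      obtain ⟨K, hKn, hKs, hKc⟩ :=
        local_compact_nhds (ψ.isClosed_epi.isOpen_compl.mem_nhds hx)
      have h1 := hK K hKc (by
        ext y
        simp only [mem_inter_iff, mem_empty_iff_false, iff_false, not_and]
        exact fun hy hyK => hKs hyK hy)
      have h2 := hm.tendsto_atTop.eventually h1
      obtain ⟨j, hj, hjK⟩ := (h2.and (hux.eventually_mem hKn)).exists
      have : u j ∈ (φ (m j)).epi ∩ K := ⟨hu j, hjK⟩
      rw [hj] at this
      exact this
    · intro x hx
      have hne : ∀ ε : ℝ, 0 < ε → ∀ᶠ m in atTop, ∃ y ∈ (φ m).epi, dist x y < ε := by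
        intro ε hε
        filter_upwards [hG (Metric.ball x ε) Metric.isOpen_ball ⟨x, hx, Metric.mem_ball_self hε⟩]
          with m ⟨y, hy, hyb⟩
        exact ⟨y, hy, by rw [dist_comm]; exact hyb⟩
      obtain ⟨M, hM⟩ := eventually_atTop.1 (hne 1 one_pos)
      have hch : ∀ m, ∃ y : E n × ℝ, M < m →
          y ∈ (φ m).epi ∧ dist x y < Metric.infDist x (φ m).epi + 1 / ((m : ℝ) + 1) := by
        intro m
        by_cases hm : M < m
        · obtain ⟨z, hz, -⟩ := hM m hm.le
          obtain ⟨y, hy, hy'⟩ := (Metric.infDist_lt_iff ⟨z, hz⟩).1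
            (lt_add_of_pos_right (Metric.infDist x (φ m).epi)
              (Nat.one_div_pos_of_nat (α := ℝ) (n := m)))
          exact ⟨y, fun _ => ⟨hy, hy'⟩⟩
        · exact ⟨x, fun h => absurd h hm⟩
      choose u hu using hch
      refine ⟨M, u, fun m hm => (hu m hm).1, ?_⟩
      rw [Metric.tendsto_atTop']
      intro ε hε
      obtain ⟨N, hN⟩ := eventually_atTop.1 (hne (ε / 2) (half_pos hε))
      obtain ⟨N', hN'⟩ := eventually_atTop.1
        ((tendsto_one_div_add_atTop_nhds_zero_nat (𝕜 := ℝ)).eventually_lt_const (half_pos hε))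
      refine ⟨max M (max N N'), fun m hm => ?_⟩
      have hm1 : M < m := lt_of_le_of_lt (le_max_left _ _) hm
      have hm2 : N ≤ m := ((le_max_left _ _).trans (le_max_right _ _)).trans hm.le
      have hm3 : N' ≤ m := ((le_max_right _ _).trans (le_max_right _ _)).trans hm.le
      obtain ⟨y, hy, hy'⟩ := hN m hm2
      have := Metric.infDist_le_dist_of_mem (x := x) hy
      have h3 := hN' m hm3
      have h4 := (hu m hm1).2
      rw [dist_comm]
      linarith
  · rintro ⟨h1, h2⟩
    refine TopologicalSpace.tendsto_nhds_generateFrom_iff.2 ?_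
    rintro U (⟨K, hK, rfl⟩ | ⟨G, hG, rfl⟩) hU
    · change ∀ᶠ m in atTop, (φ m).epi ∩ K = ∅
      by_contra hcon
      obtain ⟨m, hm, hmne⟩ := extraction_of_frequently_atTop (not_eventually.1 hcon)
      choose u hu using fun j => nonempty_iff_ne_empty.2 (hmne j)
      obtain ⟨x, hxK, k, hk, hkx⟩ := hK.tendsto_subseq (fun j => (hu j).2)
      have hx : x ∈ ψ.epi := h1 ⟨m ∘ k, hm.comp hk, u ∘ k, fun j => (hu (k j)).1, hkx⟩
      have hxm : x ∈ ψ.epi ∩ K := ⟨hx, hxK⟩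
      rw [show ψ.epi ∩ K = ∅ from hU] at hxm
      exact hxm
    · obtain ⟨x, hx, hxG⟩ := hU
      obtain ⟨M, u, hu, hux⟩ := h2 hx
      change ∀ᶠ m in atTop, ((φ m).epi ∩ G).Nonempty
      filter_upwards [hux.eventually_mem (hG.mem_nhds hxG), eventually_gt_atTop M] with m hm hMm
      exact ⟨u m, hu m hMm, hm⟩

/-! ### Classes of convex functions -/

/-- `Cvx(ℝⁿ)`: closed (that is, lower semicontinuous) proper convex functions; convexity is
convexity of the epigraph. -/
def Cvx (n : ℕ) : Set (LscFun n) :=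
  {φ | Convex ℝ φ.epi ∧ (∀ x, φ x ≠ ⊥) ∧ ∃ x, φ x ≠ ⊤}

/-- `Cvx₀(ℝⁿ)`: geometric convex functions, that is, non-negative ones vanishing at the origin. -/
def Cvx0 (n : ℕ) : Set (LscFun n) :=
  {φ ∈ Cvx n | (∀ x, 0 ≤ φ x) ∧ φ 0 = 0}

/-- The integral `∫ e^{-φ(x)} dx ∈ [0, ∞]`, with `e^{-∞} = 0`. -/
def LscFun.mass {n : ℕ} (φ : LscFun n) : ENNReal :=
  ∫⁻ x, EReal.exp (-φ x)

/-- The first moment `∫ x e^{-φ(x)} dx ∈ ℝⁿ`. -/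
def LscFun.moment {n : ℕ} (φ : LscFun n) : E n :=
  ∫ x, (EReal.exp (-φ x)).toReal • x

/-- `Cvx⁺(ℝⁿ)`: functions in `Cvx(ℝⁿ)` with `0 < ∫ e^{-φ} < ∞`. -/
def CvxPos (n : ℕ) : Set (LscFun n) :=
  {φ ∈ Cvx n | 0 < φ.mass ∧ φ.mass < ⊤}

/-- The first standard basis vector of `ℝⁿ`, `n ≥ 1`. -/
def e1 (n : ℕ) [NeZero n] : E n := EuclideanSpace.single 0 1

/-- `S₁`: functions in `Cvx₀` with `t e₁ + B ⊆ G_φ(1) ⊆ 2n B` for some `t ∈ [0, n]`, where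
`B` is the closed Euclidean unit ball. -/
def S1 (n : ℕ) [NeZero n] : Set (LscFun n) :=
  {φ ∈ Cvx0 n | ∃ t : ℝ, 0 ≤ t ∧ t ≤ n ∧
    Metric.closedBall (t • e1 n) 1 ⊆ φ.sublevel 1 ∧
    φ.sublevel 1 ⊆ Metric.closedBall 0 (2 * n)}

/-- `S₁,c`: functions in `S₁` with `∫ x e^{-φ(x)} dx = 0`, that is, with centroid `0`. (On `S₁` the
integrand is integrable and `0 < ∫ e^{-φ} < ∞`.) -/
def S1c (n : ℕ) [NeZero n] : Set (LscFun n) :=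
  {φ ∈ S1 n | φ.moment = 0}

/-- `S₂`: functions in `Cvx⁺` with `t e₁ + B ⊆ G_φ(2n) ⊆ 2n B` for some `t ∈ [0, n]`,
`inf φ = 0` and `0 ≤ φ(0) ≤ n`. -/
def S2 (n : ℕ) [NeZero n] : Set (LscFun n) :=
  {φ ∈ CvxPos n | ∃ t : ℝ, 0 ≤ t ∧ t ≤ n ∧
    Metric.closedBall (t • e1 n) 1 ⊆ φ.sublevel (2 * n) ∧
    φ.sublevel (2 * n) ⊆ Metric.closedBall 0 (2 * n) ∧
    (⨅ x, φ x) = 0 ∧ 0 ≤ φ 0 ∧ φ 0 ≤ ((n : ℝ) : EReal)}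

end BlaschkeSantalo

end

/-!
Taking epigraphs embeds the `τ`-topology in the Fell topology on the closed subsets of `ℝⁿ × ℝ`.
By the Alexander subbase lemma the Fell hyperspace is compact, and the epigraphs are the closed sets
stable under the upward translations, which is a closed condition; so `τ` is compact and only
closedness is at stake.

A sublevel inclusion `G_φ(h) ⊆ R B` is not by itself a closed condition, because `G_φ(h)` may grow
in the limit. For convex `φ` with `φ(0) ≤ c < h` it is equivalent to `epi φ` lying in the closed
region `(h - c) ‖x‖ ≤ R (max s h - c)`, which also bounds all such `φ ≥ 0` below by a common
linearly growing function.

If convex functions `φ_m` converge to `φ` in `τ`, then interior points of `epi φ` eventually lie in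
`epi φ_m`; as `epi φ` has a null frontier, `φ_m → φ` almost everywhere. By dominated convergence,
with the bound from the linear growth, the moment is continuous.
-/

namespace BlaschkeSantalo

section SetValuedMaps

variable {α X : Type*} [TopologicalSpace α] [TopologicalSpace X] {S : α → Set X}

theorem isClosed_graph_of_isOpen_disjoint_closure [LocallyCompactSpace X] [T2Space X]
    {𝓑 : Set (Set X)} (h𝓑 : TopologicalSpace.IsTopologicalBasis 𝓑) (hS : ∀ a, IsClosed (S a))
    (hopen : ∀ b ∈ 𝓑, IsCompact (closure b) → IsOpen {a | Disjoint (S a) (closure b)}) :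
    IsClosed {q : α × X | q.2 ∈ S q.1} := by
  refine isOpen_compl_iff.1 (isOpen_iff_mem_nhds.2 ?_)
  rintro ⟨a, x⟩ (hx : x ∉ S a)
  obtain ⟨K, hKx, hKS, hK⟩ := local_compact_nhds ((hS a).isOpen_compl.mem_nhds hx)
  obtain ⟨b, hb, hxb, hbK⟩ := h𝓑.mem_nhds_iff.1 hKx
  have hclosure : closure b ⊆ K := closure_minimal hbK hK.isClosed
  have hmiss : {a' | Disjoint (S a') (closure b)} ∈ 𝓝 a :=
    (hopen b hb (hK.of_isClosed_subset isClosed_closure hclosure)).mem_nhds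
      (subset_compl_iff_disjoint_left.1 (hclosure.trans hKS))
  filter_upwards [prod_mem_nhds hmiss ((h𝓑.isOpen hb).mem_nhds hxb)] with q hq hmem
  exact hq.1.notMem_of_mem_left hmem (subset_closure hq.2)

theorem isOpen_disjoint_of_isClosed_graph (hS : IsClosed {q : α × X | q.2 ∈ S q.1}) {K : Set X}
    (hK : IsCompact K) : IsOpen {a | Disjoint (S a) K} := by
  simp only [disjoint_right]
  exact isOpen_iff_eventually.2 fun a ha =>
    hK.eventually_forall_of_forall_eventually fun x hx => hS.isOpen_compl.mem_nhds (ha hx)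

end SetValuedMaps

section LinearFunctionals

variable {V : Type*} [NormedAddCommGroup V] [NormedSpace ℝ V] {A : Set V} {p : V}

theorem exists_norm_eq_one_forall_apply_le_of_notMem (hA : Convex ℝ A) (hclosed : IsClosed A)
    (hne : A.Nonempty) (hp : p ∉ A) : ∃ f : StrongDual ℝ V, ‖f‖ = 1 ∧ ∀ a ∈ A, f a ≤ f p := by
  obtain ⟨f, u, hfA, hfp⟩ := geometric_hahn_banach_closed_point hA hclosed hp
  have hf : f ≠ 0 := by
    rintro rfl
    obtain ⟨a, ha⟩ := hne
    simpa using (hfA a ha).trans hfp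
  refine ⟨‖f‖⁻¹ • f, by simp [norm_smul, hf], fun a ha => ?_⟩
  exact mul_le_mul_of_nonneg_left ((hfA a ha).trans hfp).le (inv_nonneg.2 (norm_nonneg f))

theorem exists_mem_lt_apply_of_mem_interior {f : StrongDual ℝ V} (hf : f ≠ 0)
    (hp : p ∈ interior A) : ∃ a ∈ A, f p < f a := by
  have himage : f '' interior A ∈ 𝓝 (f p) :=
    (f.isOpenMap_of_ne_zero hf _ isOpen_interior).mem_nhds (mem_image_of_mem f hp)
  obtain ⟨_, hlt, a, ha, rfl⟩ := Filter.Eventually.exists_gt himage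
  exact ⟨a, interior_subset ha, hlt⟩

end LinearFunctionals

/-- The hyperspace of closed subsets of `X` with the Fell topology, in which the `τ`-topology is
embedded by taking epigraphs. It is a synonym of `TopologicalSpace.Closeds X`, on which Mathlib
already puts the topology of the Hausdorff distance when `X` is a metric space. -/
def FellSpace (X : Type*) [TopologicalSpace X] : Type _ :=
  TopologicalSpace.Closeds X

namespace FellSpace

variable {X : Type*} [TopologicalSpace X]

instance : SetLike (FellSpace X) X :=
  inferInstanceAs (SetLike (TopologicalSpace.Closeds X) X)

instance : TopologicalSpace (FellSpace X) :=
  TopologicalSpace.generateFrom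
    ((fun K : Set X => {A : FellSpace X | Disjoint (A : Set X) K}) '' {K | IsCompact K} ∪
      (fun G : Set X => {A : FellSpace X | ((A : Set X) ∩ G).Nonempty}) '' {G | IsOpen G})

theorem isClosed (A : FellSpace X) : IsClosed (A : Set X) :=
  TopologicalSpace.Closeds.isClosed A

theorem isOpen_setOfPred_disjoint {K : Set X} (hK : IsCompact K) :
    IsOpen {A : FellSpace X | Disjoint (A : Set X) K} :=
  TopologicalSpace.isOpen_generateFrom_of_mem (Or.inl ⟨K, hK, rfl⟩)

theorem isOpen_setOfPred_inter_nonempty {G : Set X} (hG : IsOpen G) :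
    IsOpen {A : FellSpace X | ((A : Set X) ∩ G).Nonempty} :=
  TopologicalSpace.isOpen_generateFrom_of_mem (Or.inr ⟨G, hG, rfl⟩)

theorem isClosed_setOfPred_inter_nonempty {K : Set X} (hK : IsCompact K) :
    IsClosed {A : FellSpace X | ((A : Set X) ∩ K).Nonempty} := by
  simp only [← not_disjoint_iff_nonempty_inter]
  exact (isOpen_setOfPred_disjoint hK).isClosed_compl

theorem isClosed_setOfPred_subset {C : Set X} (hC : IsClosed C) :
    IsClosed {A : FellSpace X | (A : Set X) ⊆ C} := by
  simp only [← isOpen_compl_iff, compl_ofPred, ← inter_compl_nonempty_iff]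
  exact isOpen_setOfPred_inter_nonempty hC.isOpen_compl

theorem eventually_inter_nonempty {A : FellSpace X} {x : X} (hx : x ∈ A) {U : Set X}
    (hU : U ∈ 𝓝 x) : ∀ᶠ B : FellSpace X in 𝓝 A, ((B : Set X) ∩ U).Nonempty := by
  filter_upwards [(isOpen_setOfPred_inter_nonempty isOpen_interior).mem_nhds
    ⟨x, hx, mem_interior_iff_mem_nhds.2 hU⟩] with B hB
  exact hB.mono (inter_subset_inter_right _ interior_subset)

instance : CompactSpace (FellSpace X) := by
  refine ⟨isCompact_generateFrom rfl fun P hP hcover => ?_⟩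
  let hit (G : Set X) : Set (FellSpace X) := {A | ((A : Set X) ∩ G).Nonempty}
  let 𝒢 : Set (Set X) := {G | IsOpen G ∧ hit G ∈ P}
  -- The members of `P` of the form `hit G` all miss the closed set `(⋃₀ 𝒢)ᶜ`.
  let A₀ : FellSpace X := ⟨(⋃₀ 𝒢)ᶜ, (isOpen_sUnion fun G hG => hG.1).isClosed_compl⟩
  obtain ⟨V, hVP, hV⟩ := hcover (mem_univ A₀)
  rcases hP hVP with ⟨K, hK, rfl⟩ | ⟨G, hG, rfl⟩
  · have hK𝒢 : K ⊆ ⋃ G ∈ 𝒢, G :=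
      sUnion_eq_biUnion (s := 𝒢) ▸ disjoint_compl_left_iff_subset.1 hV
    obtain ⟨F, hF𝒢, hF, hKF⟩ := hK.elim_finite_subcover_image (c := id) (fun G hG => hG.1) hK𝒢
    refine ⟨insert {A : FellSpace X | Disjoint (A : Set X) K} (hit '' F), insert_subset hVP ?_,
      (hF.image _).insert _, fun A _ => ?_⟩
    · exact image_subset_iff.2 fun G hG => (hF𝒢 hG).2
    · by_cases hAK : Disjoint (A : Set X) K
      · exact ⟨_, mem_insert _ _, hAK⟩
      · obtain ⟨x, hxA, hxK⟩ := not_disjoint_iff.1 hAK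
        obtain ⟨G, hGF, hxG⟩ := mem_iUnion₂.1 (hKF hxK)
        exact ⟨hit G, mem_insert_of_mem _ (mem_image_of_mem _ hGF), x, hxA, hxG⟩
  · obtain ⟨x, hxA₀, hxG⟩ := hV
    have hx𝒢 : x ∈ ⋃₀ 𝒢 := ⟨G, ⟨hG, hVP⟩, hxG⟩
    exact absurd hx𝒢 hxA₀

section LocallyCompact

variable [LocallyCompactSpace X] [T2Space X]

theorem isClosed_setOfPred_mem : IsClosed {q : FellSpace X × X | q.2 ∈ q.1} :=
  isClosed_graph_of_isOpen_disjoint_closure TopologicalSpace.isTopologicalBasis_opens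
    isClosed fun _ _ hb => isOpen_setOfPred_disjoint hb

theorem isClosed_setOfPred_forall_mem₂ {f : X → X → X}
    (hf : Continuous fun q : X × X => f q.1 q.2) :
    IsClosed {A : FellSpace X | ∀ x ∈ A, ∀ y ∈ A, f x y ∈ A} := by
  refine isOpen_compl_iff.1 (isOpen_iff_mem_nhds.2 fun A hA => ?_)
  simp only [mem_compl_iff, mem_ofPred_eq, not_forall] at hA
  obtain ⟨x, hx, y, hy, hxy⟩ := hA
  obtain ⟨𝒰, h𝒰, W, hW, hmiss⟩ :=
    mem_nhds_prod_iff.1 (isClosed_setOfPred_mem.isOpen_compl.mem_nhds (x := (A, f x y)) hxy)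
  obtain ⟨U, hU, V, hV, hUV⟩ := mem_nhds_prod_iff.1 (hf.continuousAt (x := (x, y)) hW)
  filter_upwards [h𝒰, eventually_inter_nonempty hx hU, eventually_inter_nonempty hy hV]
    with B hB ⟨x', hx'B, hx'U⟩ ⟨y', hy'B, hy'V⟩ hclosed
  exact hmiss (mk_mem_prod hB (hUV (mk_mem_prod hx'U hy'V))) (hclosed x' hx'B y' hy'B)

theorem isClosed_setOfPred_mapsTo {f : X → X} (hf : Continuous f) :
    IsClosed {A : FellSpace X | MapsTo f A A} := by
  have hmapsTo : {A : FellSpace X | MapsTo f A A} =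
      {A : FellSpace X | ∀ x ∈ A, ∀ y ∈ A, f x ∈ A} :=
    ext fun A => ⟨fun h x hx _ _ => h hx, fun h x hx => h x hx x hx⟩
  rw [hmapsTo]
  exact isClosed_setOfPred_forall_mem₂ (hf.comp continuous_fst)

instance [SecondCountableTopology X] : SecondCountableTopology (FellSpace X) := by
  let 𝓑 := TopologicalSpace.countableBasis X
  have h𝓑 : TopologicalSpace.IsTopologicalBasis 𝓑 := TopologicalSpace.isBasis_countableBasis X
  have h𝓑_countable : 𝓑.Countable := TopologicalSpace.countable_countableBasis X
  let C : Set (Set (FellSpace X)) :=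
    (fun b => {A : FellSpace X | Disjoint (A : Set X) (closure b)}) ''
        {b ∈ 𝓑 | IsCompact (closure b)} ∪
      (fun b => {A : FellSpace X | ((A : Set X) ∩ b).Nonempty}) '' 𝓑
  refine ⟨C, ((h𝓑_countable.mono (sep_subset _ _)).image _).union (h𝓑_countable.image _),
    le_antisymm (le_generateFrom ?_) (le_generateFrom ?_)⟩
  · rintro _ (⟨b, hb, rfl⟩ | ⟨b, hb, rfl⟩)
    · exact isOpen_setOfPred_disjoint hb.2
    · exact isOpen_setOfPred_inter_nonempty (h𝓑.isOpen hb)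
  · let _ : TopologicalSpace (FellSpace X) := TopologicalSpace.generateFrom C
    rintro _ (⟨K, hK, rfl⟩ | ⟨G, hG, rfl⟩)
    · have hgraph : IsClosed {q : FellSpace X × X | q.2 ∈ (q.1 : Set X)} :=
        isClosed_graph_of_isOpen_disjoint_closure h𝓑 isClosed fun b hb hcompact =>
          TopologicalSpace.isOpen_generateFrom_of_mem (Or.inl ⟨b, ⟨hb, hcompact⟩, rfl⟩)
      exact isOpen_disjoint_of_isClosed_graph hgraph hK
    · refine isOpen_iff_mem_nhds.2 fun A ⟨x, hxA, hxG⟩ => ?_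
      obtain ⟨b, hb, hxb, hbG⟩ := h𝓑.mem_nhds_iff.1 (hG.mem_nhds hxG)
      have hopen : IsOpen {B : FellSpace X | ((B : Set X) ∩ b).Nonempty} :=
        TopologicalSpace.isOpen_generateFrom_of_mem (Or.inr ⟨b, hb, rfl⟩)
      filter_upwards [hopen.mem_nhds ⟨x, hxA, hxb⟩] with B hB
      exact hB.mono (inter_subset_inter_right _ hbG)

end LocallyCompact

section Convex

variable {V : Type*} [NormedAddCommGroup V] [NormedSpace ℝ V] [FiniteDimensional ℝ V]

theorem isClosed_setOfPred_convex : IsClosed {A : FellSpace V | Convex ℝ (A : Set V)} := by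
  have := FiniteDimensional.proper_real V
  have hconvex : {A : FellSpace V | Convex ℝ (A : Set V)} =
      ⋂ a : ℝ, ⋂ b : ℝ, ⋂ _ : 0 ≤ a, ⋂ _ : 0 ≤ b, ⋂ _ : a + b = 1,
        {A : FellSpace V | ∀ x ∈ A, ∀ y ∈ A, a • x + b • y ∈ A} := by
    ext A
    simp only [mem_ofPred_eq, mem_iInter]
    exact ⟨fun h a b ha hb hab x hx y hy => h hx hy ha hb hab,
      fun h x hx y hy a b ha hb hab => h a b ha hb hab x hx y hy⟩
  rw [hconvex]
  exact isClosed_iInter fun a => isClosed_iInter fun b => isClosed_iInter fun _ =>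
    isClosed_iInter fun _ => isClosed_iInter fun _ => isClosed_setOfPred_forall_mem₂ (by fun_prop)

-- If `p ∉ B` then some unit functional attains its supremum over `B ∪ {p}` at `p`; as `p` is
-- interior to `A`, no unit functional does so for `A`, and by compactness of the dual sphere this
-- persists for all `B` near `A`.
theorem eventually_mem_of_mem_interior {A : FellSpace V} {p : V} (hp : p ∈ interior (A : Set V)) :
    ∀ᶠ B in 𝓝[{B : FellSpace V | Convex ℝ (B : Set V)}] A, p ∈ B := by
  have := FiniteDimensional.proper_real (StrongDual ℝ V)
  have hlocal : ∀ f ∈ Metric.sphere (0 : StrongDual ℝ V) 1,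
      ∀ᶠ q : FellSpace V × StrongDual ℝ V in 𝓝 (A, f), ∃ a ∈ q.1, q.2 p < q.2 a := by
    intro f hf
    obtain ⟨a, haA, hpa⟩ :=
      exists_mem_lt_apply_of_mem_interior (ne_zero_of_mem_unit_sphere ⟨f, hf⟩) hp
    have hlt : ∀ᶠ q : StrongDual ℝ V × V in 𝓝 (f, a), q.1 p < q.1 q.2 :=
      (isOpen_lt (by fun_prop) (by fun_prop)).mem_nhds hpa
    obtain ⟨𝒰, h𝒰, W, hW, h𝒰W⟩ := mem_nhds_prod_iff.1 hlt
    filter_upwards [prod_mem_nhds (eventually_inter_nonempty haA hW) h𝒰]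
      with q ⟨⟨b, hb, hbW⟩, hq⟩
    exact ⟨b, hb, h𝒰W (mk_mem_prod hq hbW)⟩
  have hsphere : ∀ᶠ B : FellSpace V in 𝓝 A,
      ∀ f ∈ Metric.sphere (0 : StrongDual ℝ V) 1, ∃ a ∈ B, f p < f a :=
    (isCompact_sphere _ _).eventually_forall_of_forall_eventually hlocal
  filter_upwards [self_mem_nhdsWithin, nhdsWithin_le_nhds hsphere,
    nhdsWithin_le_nhds (eventually_inter_nonempty (interior_subset hp) univ_mem)]
    with B hconvex hlt hB
  by_contra hpB
  obtain ⟨f, hf, hle⟩ := exists_norm_eq_one_forall_apply_le_of_notMem hconvex B.isClosed hB.left hpB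
  obtain ⟨a, ha, hpa⟩ := hlt f (mem_sphere_zero_iff_norm.2 hf)
  exact (hle a ha).not_gt hpa

end Convex

end FellSpace

namespace LscFun

variable {n : ℕ}

theorem mem_epi_of_le {φ : LscFun n} {x : E n} {s t : ℝ} (hs : (x, s) ∈ φ.epi) (hst : s ≤ t) :
    (x, t) ∈ φ.epi :=
  le_trans (b := (s : EReal)) hs (EReal.coe_le_coe_iff.2 hst)

/-- The epigraph as a point of the Fell hyperspace of `ℝⁿ × ℝ`; the `τ`-topology is the topology
induced by this map. -/
def toFell (φ : LscFun n) : FellSpace (E n × ℝ) :=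
  ⟨φ.epi, φ.isClosed_epi⟩

theorem isInducing_toFell : IsInducing (toFell (n := n)) := by
  refine ⟨?_⟩
  rw [FellSpace.instTopologicalSpace, induced_generateFrom_eq, image_union, image_image,
    image_image]
  refine congrArg TopologicalSpace.generateFrom (congrArg₂ (· ∪ ·) ?_ ?_)
  · ext U
    refine exists_congr fun K => and_congr_right fun _ => ?_
    simp only [disjoint_iff_inter_eq_empty, eq_comm (a := U)]
    rfl
  · ext U
    exact exists_congr fun G => and_congr_right fun _ => eq_comm

theorem continuous_toFell : Continuous (toFell (n := n)) :=
  isInducing_toFell.continuous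

theorem iInf_coe_le_coe_iff {A : Set (E n × ℝ)} (hclosed : IsClosed A)
    (hmono : ∀ ⦃x s t⦄, (x, s) ∈ A → s ≤ t → (x, t) ∈ A) {x : E n} {s : ℝ} :
    ⨅ r : {r : ℝ // (x, r) ∈ A}, ((r : ℝ) : EReal) ≤ s ↔ (x, s) ∈ A := by
  refine ⟨fun h => ?_, fun h => iInf_le_of_le ⟨s, h⟩ le_rfl⟩
  have hmem : ∀ t ∈ Ioi s, (x, t) ∈ A := by
    intro t ht
    obtain ⟨⟨r, hr⟩, hrt⟩ := iInf_lt_iff.1 (h.trans_lt (EReal.coe_lt_coe_iff.2 ht))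
    exact hmono hr (EReal.coe_lt_coe_iff.1 hrt).le
  have hs : s ∈ closure (Ioi s) := by simp
  exact closure_minimal (t := {t | (x, t) ∈ A}) hmem (hclosed.preimage (by fun_prop)) hs

/-- The function with epigraph `A`, namely `x ↦ inf {s | (x, s) ∈ A}`. -/
noncomputable def ofEpi (A : Set (E n × ℝ)) (hclosed : IsClosed A)
    (hmono : ∀ ⦃x s t⦄, (x, s) ∈ A → s ≤ t → (x, t) ∈ A) : LscFun n where
  toFun x := ⨅ r : {r : ℝ // (x, r) ∈ A}, ((r : ℝ) : EReal)
  lsc' := by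
    intro x y hy
    obtain ⟨s, hys, hs⟩ := EReal.lt_iff_exists_real_btwn.1 hy
    have hxs : (x, s) ∉ A := fun h => hs.not_ge ((iInf_coe_le_coe_iff hclosed hmono).2 h)
    have hnear : ∀ᶠ x' in 𝓝 x, (x', s) ∉ A :=
      (Continuous.prodMk_left s).continuousAt.eventually_mem (hclosed.isOpen_compl.mem_nhds hxs)
    filter_upwards [hnear] with x' hx'
    exact hys.trans (not_le.1 fun h => hx' ((iInf_coe_le_coe_iff hclosed hmono).1 h))

theorem epi_ofEpi {A : Set (E n × ℝ)} (hclosed : IsClosed A)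
    (hmono : ∀ ⦃x s t⦄, (x, s) ∈ A → s ≤ t → (x, t) ∈ A) : (ofEpi A hclosed hmono).epi = A :=
  ext fun _ => iInf_coe_le_coe_iff hclosed hmono

theorem range_toFell : range (toFell (n := n)) =
    ⋂ δ : {δ : ℝ // 0 ≤ δ}, {A : FellSpace (E n × ℝ) |
      MapsTo (fun p : E n × ℝ => (p.1, p.2 + δ)) A A} := by
  ext A
  simp only [mem_range, mem_iInter, mem_ofPred_eq, Subtype.forall]
  constructor
  · rintro ⟨φ, rfl⟩ δ hδ p hp
    exact mem_epi_of_le hp (le_add_of_nonneg_right hδ)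
  · intro h
    refine ⟨ofEpi A A.isClosed fun x s t hs hst => ?_, SetLike.coe_injective (epi_ofEpi _ _)⟩
    simpa using h (t - s) (sub_nonneg.2 hst) hs

instance : CompactSpace (LscFun n) := by
  refine ⟨isInducing_toFell.isCompact_iff.2 ?_⟩
  rw [image_univ, range_toFell]
  exact (isClosed_iInter fun δ => FellSpace.isClosed_setOfPred_mapsTo (by fun_prop)).isCompact

instance : SecondCountableTopology (LscFun n) :=
  isInducing_toFell.secondCountableTopology

theorem isClosed_setOfPred_convex_epi : IsClosed {φ : LscFun n | Convex ℝ φ.epi} :=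
  FellSpace.isClosed_setOfPred_convex.preimage continuous_toFell

theorem isClosed_setOfPred_epi_subset {C : Set (E n × ℝ)} (hC : IsClosed C) :
    IsClosed {φ : LscFun n | φ.epi ⊆ C} :=
  (FellSpace.isClosed_setOfPred_subset hC).preimage continuous_toFell

theorem isClosed_setOfPred_epi_inter_nonempty {K : Set (E n × ℝ)} (hK : IsCompact K) :
    IsClosed {φ : LscFun n | (φ.epi ∩ K).Nonempty} :=
  (FellSpace.isClosed_setOfPred_inter_nonempty hK).preimage continuous_toFell

theorem isClosed_setOfPred_mem_epi : IsClosed {q : LscFun n × (E n × ℝ) | q.2 ∈ q.1.epi} :=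
  FellSpace.isClosed_setOfPred_mem.preimage (continuous_toFell.prodMap continuous_id)

theorem isClosed_setOfPred_exists_closedBall_subset_sublevel {T : Type*} [TopologicalSpace T]
    {K : Set T} (hK : IsCompact K) {f : T → E n} (hf : Continuous f) (ρ h : ℝ) :
    IsClosed {φ : LscFun n | ∃ t ∈ K, Metric.closedBall (f t) ρ ⊆ φ.sublevel h} := by
  have hball (φ : LscFun n) (t : T) : Metric.closedBall (f t) ρ ⊆ φ.sublevel h ↔
      ∀ v ∈ Metric.closedBall (0 : E n) ρ, (f t + v, h) ∈ φ.epi := by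
    refine ⟨fun hsub v hv => hsub (by simpa using hv), fun hsub x hx => ?_⟩
    have hmem : (f t + (x - f t), h) ∈ φ.epi := hsub _ (by simpa [dist_eq_norm] using hx)
    rwa [add_sub_cancel] at hmem
  have hclosed : IsClosed {q : LscFun n × T | Metric.closedBall (f q.2) ρ ⊆ q.1.sublevel h} := by
    simp only [hball, ofPred_forall]
    exact isClosed_iInter fun v => isClosed_iInter fun _ => isClosed_setOfPred_mem_epi.preimage
      (f := fun q : LscFun n × T => (q.1, (f q.2 + v, h))) (by fun_prop)
  refine isOpen_compl_iff.1 (isOpen_iff_eventually.2 fun φ hφ => ?_)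
  simp only [mem_compl_iff, mem_ofPred_eq, not_exists, not_and] at hφ ⊢
  exact hK.eventually_forall_of_forall_eventually fun t ht =>
    hclosed.isOpen_compl.mem_nhds (hφ t ht)

theorem lowerSemicontinuous_apply (x : E n) : LowerSemicontinuous fun φ : LscFun n => φ x := by
  intro φ a ha
  obtain ⟨s, has, hs⟩ := EReal.lt_iff_exists_real_btwn.1 ha
  have hnear : ∀ᶠ φ' in 𝓝 φ, (x, s) ∉ φ'.epi :=
    (Continuous.prodMk_left (x, s)).continuousAt.eventually_mem
      (isClosed_setOfPred_mem_epi.isOpen_compl.mem_nhds (x := (φ, (x, s))) hs.not_ge)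
  exact hnear.mono fun φ' hφ' => has.trans (not_le.1 hφ')

theorem eventually_mem_epi_of_mem_interior {ψ : LscFun n} {p : E n × ℝ}
    (hp : p ∈ interior ψ.epi) : ∀ᶠ φ in 𝓝[{φ : LscFun n | Convex ℝ φ.epi}] ψ, p ∈ φ.epi :=
  (continuous_toFell.continuousAt.continuousWithinAt.tendsto_nhdsWithin fun _ h => h).eventually
    (FellSpace.eventually_mem_of_mem_interior hp)

theorem ae_forall_ae_notMem_frontier_epi {ψ : LscFun n} (hψ : Convex ℝ ψ.epi) :
    ∀ᵐ x : E n, ∀ᵐ s : ℝ, (x, s) ∉ frontier ψ.epi := by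
  have hnull : ∀ᵐ p : E n × ℝ ∂((volume : Measure (E n)).prod (volume : Measure ℝ)),
      p ∉ frontier ψ.epi :=
    measure_eq_zero_iff_ae_notMem.1 (hψ.addHaar_frontier _)
  exact Measure.ae_ae_of_ae_prod hnull

theorem ae_continuousWithinAt_apply {ψ : LscFun n} (hψ : Convex ℝ ψ.epi) :
    ∀ᵐ x : E n, ContinuousWithinAt (fun φ : LscFun n => φ x) {φ | Convex ℝ φ.epi} ψ := by
  filter_upwards [ae_forall_ae_notMem_frontier_epi hψ] with x hx
  refine tendsto_order.2 ⟨fun a ha => nhdsWithin_le_nhds (lowerSemicontinuous_apply x ψ a ha), ?_⟩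
  intro a ha
  obtain ⟨s, hs, hsa⟩ := EReal.lt_iff_exists_real_btwn.1 ha
  obtain ⟨t, hst, hta⟩ := EReal.lt_iff_exists_real_btwn.1 hsa
  obtain ⟨r, hr, hsr, hrt⟩ := (Measure.dense_of_ae hx).exists_between (EReal.coe_lt_coe_iff.1 hst)
  have hmem : (x, r) ∈ ψ.epi := mem_epi_of_le (s := s) hs.le hsr.le
  have hint : (x, r) ∈ interior ψ.epi := by
    by_contra hnot
    exact hr ⟨subset_closure hmem, hnot⟩
  filter_upwards [eventually_mem_epi_of_mem_interior hint] with φ hφ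
  exact (show φ x ≤ (r : EReal) from hφ).trans_lt ((EReal.coe_lt_coe_iff.2 hrt).trans hta)

end LscFun

section ExponentialDecay

variable {F : Type*} [NormedAddCommGroup F] [NormedSpace ℝ F] [FiniteDimensional ℝ F]
  [MeasurableSpace F] [BorelSpace F] {μ : Measure F} [μ.IsAddHaarMeasure]

theorem integrable_norm_pow_mul_exp_neg_mul_norm {b : ℝ} (hb : 0 < b) (k : ℕ) :
    Integrable (fun x => ‖x‖ ^ k * Real.exp (-(b * ‖x‖))) μ := by
  rcases subsingleton_or_nontrivial F with hF | hF
  · exact Continuous.integrable_of_hasCompactSupport (by fun_prop)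
      (HasCompactSupport.of_compactSpace _)
  · have hexponent : (-1 : ℝ) < (Module.finrank ℝ F - 1 + k : ℕ) :=
      neg_one_lt_zero.trans_le (Nat.cast_nonneg _)
    rw [integrable_fun_norm_addHaar μ (f := fun r => r ^ k * Real.exp (-(b * r)))]
    refine (integrableOn_rpow_mul_exp_neg_mul_rpow hexponent one_pos hb).congr_fun
      (fun r _ => ?_) measurableSet_Ioi
    simp only [Real.rpow_natCast, Real.rpow_one, smul_eq_mul, pow_add, mul_assoc, neg_mul]

end ExponentialDecay

namespace LscFun

variable {n : ℕ} {b d : ℝ}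

theorem measurable_exp_neg (φ : LscFun n) : Measurable fun x => EReal.exp (-φ x) :=
  EReal.measurable_exp.comp (measurable_neg.comp φ.lsc'.measurable)

theorem exp_neg_le_of_linear_growth {φ : LscFun n}
    (hφ : ∀ x, ((b * ‖x‖ - d : ℝ) : EReal) ≤ φ x) (x : E n) :
    EReal.exp (-φ x) ≤ ENNReal.ofReal (Real.exp d * Real.exp (-(b * ‖x‖))) := by
  calc EReal.exp (-φ x) ≤ EReal.exp (-((b * ‖x‖ - d : ℝ) : EReal)) :=
        EReal.exp_monotone (EReal.neg_le_neg_iff.2 (hφ x))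
    _ = ENNReal.ofReal (Real.exp d * Real.exp (-(b * ‖x‖))) := by
        rw [← EReal.coe_neg, EReal.exp_coe, ← Real.exp_add, neg_sub, sub_eq_add_neg]

theorem mass_lt_top (hb : 0 < b) {φ : LscFun n}
    (hφ : ∀ x, ((b * ‖x‖ - d : ℝ) : EReal) ≤ φ x) : φ.mass < ⊤ := by
  have hint : Integrable (fun x : E n => Real.exp d * Real.exp (-(b * ‖x‖))) := by
    simpa using (integrable_norm_pow_mul_exp_neg_mul_norm hb 0).const_mul (Real.exp d)
  exact (lintegral_mono (exp_neg_le_of_linear_growth hφ)).trans_lt hint.lintegral_lt_top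

theorem mass_pos_of_closedBall_subset_sublevel {φ : LscFun n} {z : E n} {ρ h : ℝ} (hρ : 0 < ρ)
    (hball : Metric.closedBall z ρ ⊆ φ.sublevel h) : 0 < φ.mass := by
  refine (lintegral_pos_iff_support φ.measurable_exp_neg).2 ?_
  refine (Metric.measure_closedBall_pos volume z hρ).trans_le (measure_mono fun x hx => ?_)
  have hne : φ x ≠ ⊤ := ((hball hx).trans_lt (EReal.coe_lt_top h)).ne
  simpa [Function.mem_support] using hne

theorem continuousOn_moment (hb : 0 < b) : ContinuousOn moment
    {φ : LscFun n | Convex ℝ φ.epi ∧ ∀ x, ((b * ‖x‖ - d : ℝ) : EReal) ≤ φ x} := by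
  rintro ψ ⟨hconv, hψ⟩
  refine continuousWithinAt_of_dominated
    (bound := fun x => Real.exp d * (‖x‖ ^ 1 * Real.exp (-(b * ‖x‖)))) ?_ ?_ ?_ ?_
  · exact Eventually.of_forall fun φ =>
      (φ.measurable_exp_neg.ennreal_toReal.smul measurable_id).aestronglyMeasurable
  · filter_upwards [self_mem_nhdsWithin] with φ hφ
    refine Eventually.of_forall fun x => ?_
    have hexp : (EReal.exp (-φ x)).toReal ≤ Real.exp d * Real.exp (-(b * ‖x‖)) :=
      ENNReal.toReal_le_of_le_ofReal (by positivity) (exp_neg_le_of_linear_growth hφ.2 x)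
    calc ‖(EReal.exp (-φ x)).toReal • x‖ = (EReal.exp (-φ x)).toReal * ‖x‖ := by
          rw [norm_smul, Real.norm_of_nonneg ENNReal.toReal_nonneg]
      _ ≤ Real.exp d * Real.exp (-(b * ‖x‖)) * ‖x‖ := by gcongr
      _ = Real.exp d * (‖x‖ ^ 1 * Real.exp (-(b * ‖x‖))) := by ring
  · exact (integrable_norm_pow_mul_exp_neg_mul_norm hb 1).const_mul _
  · filter_upwards [ae_continuousWithinAt_apply hconv] with x hx
    have hne : EReal.exp (-ψ x) ≠ ⊤ :=
      ((exp_neg_le_of_linear_growth hψ x).trans_lt ENNReal.ofReal_lt_top).ne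
    have hexp : Tendsto (fun φ : LscFun n => EReal.exp (-φ x)) (𝓝[{φ | Convex ℝ φ.epi}] ψ)
        (𝓝 (EReal.exp (-ψ x))) :=
      ((ENNReal.continuous_exp.comp continuous_neg).tendsto _).comp hx
    exact (((ENNReal.tendsto_toReal hne).comp hexp).smul_const x).mono_left
      (nhdsWithin_mono _ fun _ h => h.1)

end LscFun

section ConvexSublevels

variable {n : ℕ} {c h R : ℝ} {φ : LscFun n}

theorem forall_nonneg_iff_epi_subset : (∀ x, 0 ≤ φ x) ↔ φ.epi ⊆ {p | 0 ≤ p.2} := by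
  refine ⟨fun hpos p hp => EReal.coe_nonneg.1 ((hpos p.1).trans hp), fun hsub x => ?_⟩
  by_contra! hx
  obtain ⟨s, hxs, hs⟩ := EReal.lt_iff_exists_real_btwn.1 hx
  exact (EReal.coe_lt_coe_iff.1 hs).not_ge (hsub (a := (x, s)) hxs.le)

-- The segment from `(0, c)` to a point `(x, s)` of the epigraph above height `h` meets that height
-- at `((h - c) / (s - c)) • x`, which lies in `G_φ(h)`.
theorem mul_norm_le_of_mem_epi (hconv : Convex ℝ φ.epi) (h0 : φ 0 ≤ (c : EReal)) (hch : c < h)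
    (hsub : φ.sublevel h ⊆ Metric.closedBall 0 R) {x : E n} {s : ℝ} (hx : (x, s) ∈ φ.epi) :
    (h - c) * ‖x‖ ≤ R * (max s h - c) := by
  have hhc : 0 < h - c := sub_pos.2 hch
  rcases le_or_gt s h with hsh | hhs
  · have hxR : ‖x‖ ≤ R := mem_closedBall_zero_iff.1 (hsub (LscFun.mem_epi_of_le hx hsh))
    rw [max_eq_right hsh, mul_comm R]
    exact mul_le_mul_of_nonneg_left hxR hhc.le
  · have hsc : 0 < s - c := sub_pos.2 (hch.trans hhs)
    set r := (h - c) / (s - c) with hr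
    have hr0 : 0 ≤ r := by positivity
    have hr1 : r ≤ 1 := (div_le_one hsc).2 (by linarith)
    have hseg : r • (x, s) + (1 - r) • ((0 : E n), c) ∈ φ.epi :=
      hconv hx h0 hr0 (sub_nonneg.2 hr1) (add_sub_cancel _ _)
    have hheight : r * s + (1 - r) * c = h := by
      rw [hr]
      field_simp
      ring
    have hmem : r • x ∈ φ.sublevel h := by
      simpa [LscFun.epi, LscFun.sublevel, hheight] using hseg
    have hnorm : r * ‖x‖ ≤ R := by
      simpa [norm_smul, abs_of_nonneg hr0] using hsub hmem
    rwa [hr, div_mul_eq_mul_div, div_le_iff₀ hsc, ← max_eq_left hhs.le] at hnorm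

theorem sublevel_subset_closedBall_iff (hconv : Convex ℝ φ.epi) (h0 : φ 0 ≤ (c : EReal))
    (hch : c < h) : φ.sublevel h ⊆ Metric.closedBall 0 R ↔
      φ.epi ⊆ {p | (h - c) * ‖p.1‖ ≤ R * (max p.2 h - c)} := by
  refine ⟨fun hsub p hp => mul_norm_le_of_mem_epi hconv h0 hch hsub hp, fun hsub x hx => ?_⟩
  have hle : (h - c) * ‖x‖ ≤ R * (max h h - c) := hsub (a := (x, h)) hx
  rw [max_self, mul_comm R] at hle
  exact mem_closedBall_zero_iff.2 (le_of_mul_le_mul_left hle (sub_pos.2 hch))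

/-- The convex functions `φ ≥ 0` on `ℝⁿ` with `φ(0) ≤ c` and `G_φ(h) ⊆ R B`. The sets `S₁` and `S₂`
are cut out of such classes by further closed conditions. -/
def boundedSublevelClass (n : ℕ) (c h R : ℝ) : Set (LscFun n) :=
  {φ | Convex ℝ φ.epi ∧ (∀ x, 0 ≤ φ x) ∧ φ 0 ≤ (c : EReal) ∧
    φ.sublevel h ⊆ Metric.closedBall 0 R}

theorem isClosed_boundedSublevelClass (hch : c < h) : IsClosed (boundedSublevelClass n c h R) := by
  have hclass : boundedSublevelClass n c h R =
      {φ | Convex ℝ φ.epi} ∩ ({φ | φ.epi ⊆ {p | 0 ≤ p.2}} ∩ ({φ | φ 0 ≤ (c : EReal)} ∩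
        {φ | φ.epi ⊆ {p | (h - c) * ‖p.1‖ ≤ R * (max p.2 h - c)}})) :=
    ext fun φ => and_congr_right fun hconv => and_congr forall_nonneg_iff_epi_subset
      (and_congr_right fun h0 => sublevel_subset_closedBall_iff hconv h0 hch)
  rw [hclass]
  refine LscFun.isClosed_setOfPred_convex_epi.inter (.inter ?_ (.inter ?_ ?_))
  · exact LscFun.isClosed_setOfPred_epi_subset (isClosed_le (by fun_prop) (by fun_prop))
  · exact (LscFun.lowerSemicontinuous_apply 0).isClosed_preimage _
  · exact LscFun.isClosed_setOfPred_epi_subset (isClosed_le (by fun_prop) (by fun_prop))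

theorem linear_growth_of_mem_boundedSublevelClass (hch : c < h) (hR : 0 < R)
    (hφ : φ ∈ boundedSublevelClass n c h R) (x : E n) :
    (((h - c) / R * ‖x‖ - (h - c) : ℝ) : EReal) ≤ φ x := by
  obtain ⟨hconv, hpos, h0, hsub⟩ := hφ
  have hh : 0 ≤ h := (EReal.coe_nonneg.1 ((hpos 0).trans h0)).trans hch.le
  refine EReal.le_of_forall_lt_iff_le.1 fun s hs => EReal.coe_le_coe_iff.2 ?_
  have hs0 : 0 ≤ s := EReal.coe_nonneg.1 ((hpos x).trans hs.le)
  have hle := mul_norm_le_of_mem_epi hconv h0 hch hsub (show (x, s) ∈ φ.epi from hs.le)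
  rw [sub_le_iff_le_add, div_mul_eq_mul_div, div_le_iff₀' hR]
  calc (h - c) * ‖x‖ ≤ R * (max s h - c) := hle
    _ ≤ R * (s + (h - c)) := by
      gcongr
      linarith [max_le_add_of_nonneg hs0 hh]

theorem iInf_eq_zero_iff_of_mem_boundedSublevelClass (hch : c ≤ h)
    (hφ : φ ∈ boundedSublevelClass n c h R) :
    ⨅ x, φ x = 0 ↔ (φ.epi ∩ Metric.closedBall 0 R ×ˢ {0}).Nonempty := by
  obtain ⟨-, hpos, h0, hsub⟩ := hφ
  have h0h : φ 0 ≤ (h : EReal) := h0.trans (EReal.coe_le_coe_iff.2 hch)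
  constructor
  · intro hinf
    obtain ⟨x, hxR, hmin⟩ := (φ.lsc'.lowerSemicontinuousOn _).exists_isMinOn ⟨0, hsub h0h⟩
      (isCompact_closedBall (0 : E n) R)
    have hx : φ x ≤ ⨅ y, φ y := by
      refine le_iInf fun y => ?_
      by_cases hy : φ y ≤ (h : EReal)
      · exact hmin (hsub hy)
      · exact (hmin (hsub h0h)).trans (h0h.trans (not_le.1 hy).le)
    exact ⟨(x, 0), by simpa [LscFun.epi] using hx.trans hinf.le, hxR, rfl⟩
  · rintro ⟨⟨x, s⟩, hx, -, rfl⟩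
    exact le_antisymm ((iInf_le _ x).trans (by simpa [LscFun.epi] using hx)) (le_iInf hpos)

end ConvexSublevels

section

variable (n : ℕ) [NeZero n]

theorem S1_eq_inter : S1 n = boundedSublevelClass n 0 1 (2 * n) ∩
    {φ | ∃ t ∈ Icc 0 (n : ℝ), Metric.closedBall (t • e1 n) 1 ⊆ φ.sublevel 1} := by
  ext φ
  constructor
  · rintro ⟨⟨⟨hconv, -, -⟩, hpos, h0⟩, t, ht0, htn, hball, hsub⟩
    exact ⟨⟨hconv, hpos, h0.le, hsub⟩, t, ⟨ht0, htn⟩, hball⟩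
  · rintro ⟨⟨hconv, hpos, h0, hsub⟩, t, ⟨ht0, htn⟩, hball⟩
    have hzero : φ 0 = 0 := le_antisymm h0 (hpos 0)
    exact ⟨⟨⟨hconv, fun x => (EReal.bot_lt_zero.trans_le (hpos x)).ne', 0, by simp [hzero]⟩,
      hpos, hzero⟩, t, ht0, htn, hball, hsub⟩

theorem S2_eq_inter : S2 n = boundedSublevelClass n n (2 * n) (2 * n) ∩
    ({φ | ∃ t ∈ Icc 0 (n : ℝ), Metric.closedBall (t • e1 n) 1 ⊆ φ.sublevel (2 * n)} ∩
      {φ | (φ.epi ∩ Metric.closedBall 0 (2 * n) ×ˢ {0}).Nonempty}) := by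
  have hn : (0 : ℝ) < n := Nat.cast_pos.2 (NeZero.pos n)
  have hn2 : (n : ℝ) < 2 * n := by linarith
  ext φ
  constructor
  · rintro ⟨⟨⟨hconv, -, -⟩, -, -⟩, t, ht0, htn, hball, hsub, hinf, -, h0⟩
    have hφ : φ ∈ boundedSublevelClass n n (2 * n) (2 * n) :=
      ⟨hconv, fun x => hinf ▸ iInf_le _ x, h0, hsub⟩
    exact ⟨hφ, ⟨t, ⟨ht0, htn⟩, hball⟩,
      (iInf_eq_zero_iff_of_mem_boundedSublevelClass hn2.le hφ).1 hinf⟩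
  · rintro ⟨hφ, ⟨t, ⟨ht0, htn⟩, hball⟩, hinf⟩
    have hmass : 0 < φ.mass ∧ φ.mass < ⊤ :=
      ⟨LscFun.mass_pos_of_closedBall_subset_sublevel one_pos hball,
        LscFun.mass_lt_top (div_pos (sub_pos.2 hn2) (by positivity))
          (linear_growth_of_mem_boundedSublevelClass hn2 (by positivity) hφ)⟩
    have hzero := (iInf_eq_zero_iff_of_mem_boundedSublevelClass hn2.le hφ).2 hinf
    obtain ⟨hconv, hpos, h0, hsub⟩ := hφ
    exact ⟨⟨⟨hconv, fun x => (EReal.bot_lt_zero.trans_le (hpos x)).ne', 0,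
      (h0.trans_lt (EReal.coe_lt_top _)).ne⟩, hmass⟩, t, ht0, htn, hball, hsub, hzero, hpos 0, h0⟩

theorem isClosed_S1 : IsClosed (S1 n) := by
  rw [S1_eq_inter]
  exact (isClosed_boundedSublevelClass one_pos).inter
    (LscFun.isClosed_setOfPred_exists_closedBall_subset_sublevel isCompact_Icc (by fun_prop) 1 1)

theorem isClosed_S1c : IsClosed (S1c n) := by
  have hn : (0 : ℝ) < n := Nat.cast_pos.2 (NeZero.pos n)
  have hmoment : ContinuousOn LscFun.moment (S1 n) := by
    refine (LscFun.continuousOn_moment (b := (1 - 0) / (2 * n)) (d := 1 - 0)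
      (by positivity)).mono fun φ hφ => ?_
    rw [S1_eq_inter] at hφ
    exact ⟨hφ.1.1, linear_growth_of_mem_boundedSublevelClass one_pos (by positivity) hφ.1⟩
  exact hmoment.preimage_isClosed_of_isClosed (isClosed_S1 n) isClosed_singleton

theorem isClosed_S2 : IsClosed (S2 n) := by
  have hn : (0 : ℝ) < n := Nat.cast_pos.2 (NeZero.pos n)
  rw [S2_eq_inter]
  refine (isClosed_boundedSublevelClass (by linarith)).inter (.inter ?_ ?_)
  · exact LscFun.isClosed_setOfPred_exists_closedBall_subset_sublevel isCompact_Icc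
      (by fun_prop) 1 (2 * n)
  · exact LscFun.isClosed_setOfPred_epi_inter_nonempty
      ((isCompact_closedBall 0 _).prod isCompact_singleton)

end

end BlaschkeSantalo

theorem mainTheorem6 (n : ℕ) [NeZero n] :
    (IsClosed (BlaschkeSantalo.S1 n) ∧ IsCompact (BlaschkeSantalo.S1 n)) ∧
    (IsClosed (BlaschkeSantalo.S1c n) ∧ IsCompact (BlaschkeSantalo.S1c n)) ∧
    (IsClosed (BlaschkeSantalo.S2 n) ∧ IsCompact (BlaschkeSantalo.S2 n)) :=
  ⟨⟨BlaschkeSantalo.isClosed_S1 n, (BlaschkeSantalo.isClosed_S1 n).isCompact⟩,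
    ⟨BlaschkeSantalo.isClosed_S1c n, (BlaschkeSantalo.isClosed_S1c n).isCompact⟩,
    ⟨BlaschkeSantalo.isClosed_S2 n, (BlaschkeSantalo.isClosed_S2 n).isCompact⟩⟩
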